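/- Let $U_1=\{(x,y)\in\mathbb R^2 : x^2+y^2<1\}$ be the unit disk and $o=(0,0)$. For every positive integer $m$ there exists a $C^1$-function $f:U_1\to\mathbb R$ such that (1) $f$ is real-analytic on $U_1\setminus\{o\}$; (2) $(0,0,f(0,0))$ is a $C^1$-umbilic of the graph of $f$, with index $1+\frac m2$. Here, for a $C^1$-immersion $P:U\to\mathbb R^3$ of an open set $U\subset\mathbb R^2$ which is $C^\infty$ on $U\setminus\{q\}$ and not $C^2$ at $q\in U$ (that is, $C^2$ on no neighbourhood of $q$), the point $q$ is called a $C^1$-umbilic if the umbilics of $P$ on $U\setminus\{q\}$ (the points where the two principal curvatures coincide) do not accumulate to $q$. Its index is the rotation index of the curvature line flow of $P$ around $q$: the total angle, divided by $2\pi$, through which a continuous field of principal directions, viewed in the parameter domain $U$, turns along any sufficiently small circle around $q$ run through once anticlockwise; it is a half-integer. The graph of $f$ is parametrized by $P(x,y)=(x,y,f(x,y))$. -/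

import Mathlib

open scoped Matrix ContDiff Topology

noncomputable section

namespace C1Umbilic

/-- Partial derivative with respect to the first coordinate of a map `P : ℝ² → ℝ³`. -/
def partialX (P : ℝ × ℝ → Fin 3 → ℝ) (p : ℝ × ℝ) : Fin 3 → ℝ :=
  fderiv ℝ P p (1, 0)

/-- Partial derivative with respect to the second coordinate of a map `P : ℝ² → ℝ³`. -/
def partialY (P : ℝ × ℝ → Fin 3 → ℝ) (p : ℝ × ℝ) : Fin 3 → ℝ :=
  fderiv ℝ P p (0, 1)

/-- The unit normal `(P_x × P_y) / |P_x × P_y|` of an immersion. -/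
def unitNormal (P : ℝ × ℝ → Fin 3 → ℝ) (p : ℝ × ℝ) : Fin 3 → ℝ :=
  let n := crossProduct (partialX P p) (partialY P p)
  (Real.sqrt (n ⬝ᵥ n))⁻¹ • n

/-- The matrix of the first fundamental form. -/
def firstForm (P : ℝ × ℝ → Fin 3 → ℝ) (p : ℝ × ℝ) : Matrix (Fin 2) (Fin 2) ℝ :=
  !![partialX P p ⬝ᵥ partialX P p, partialX P p ⬝ᵥ partialY P p;
     partialY P p ⬝ᵥ partialX P p, partialY P p ⬝ᵥ partialY P p]

/-- The matrix of the second fundamental form. -/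
def secondForm (P : ℝ × ℝ → Fin 3 → ℝ) (p : ℝ × ℝ) : Matrix (Fin 2) (Fin 2) ℝ :=
  !![partialX (partialX P) p ⬝ᵥ unitNormal P p, partialY (partialX P) p ⬝ᵥ unitNormal P p;
     partialX (partialY P) p ⬝ᵥ unitNormal P p, partialY (partialY P) p ⬝ᵥ unitNormal P p]

/-- `p` is an umbilic: the second fundamental form is a multiple of the first one
(the two principal curvatures coincide). -/
def IsUmbilic (P : ℝ × ℝ → Fin 3 → ℝ) (p : ℝ × ℝ) : Prop :=
  ∃ κ : ℝ, secondForm P p = κ • firstForm P p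

/-- `w` is a principal direction at `p`, in the coordinates of the parameter plane: it is an
eigenvector of the shape operator `I⁻¹ II`, i.e. `II w = κ I w` with `w ≠ 0`. -/
def IsPrincipalDirection (P : ℝ × ℝ → Fin 3 → ℝ) (p : ℝ × ℝ) (w : Fin 2 → ℝ) : Prop :=
  w ≠ 0 ∧ ∃ κ : ℝ, secondForm P p *ᵥ w = κ • (firstForm P p *ᵥ w)

/-- `q` is a `C¹`-umbilic of the `C¹`-immersion `P : U → ℝ³`: `P` is smooth on `U \ {q}`,
not `C²` at `q`, and the umbilics of `P` on `U \ {q}` do not accumulate to `q`. -/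
structure IsC1Umbilic (P : ℝ × ℝ → Fin 3 → ℝ) (U : Set (ℝ × ℝ)) (q : ℝ × ℝ) : Prop where
  isOpen : IsOpen U
  mem : q ∈ U
  contDiffOn : ContDiffOn ℝ 1 P U
  immersion : ∀ p ∈ U, Function.Injective (fderiv ℝ P p)
  smooth : ContDiffOn ℝ ∞ P (U \ {q})
  not_C2 : ¬ ContDiffAt ℝ 2 P q
  isolated : ∀ᶠ p in 𝓝[≠] q, ¬ IsUmbilic P p

/-- The Euclidean circle of radius `r` around `q`, run through once anticlockwise on `[0, 2π]`. -/
def circle (q : ℝ × ℝ) (r t : ℝ) : ℝ × ℝ :=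
  (q.1 + r * Real.cos t, q.2 + r * Real.sin t)

/-- The curvature line flow of `P` has rotation index `k` along the closed curve
`γ : [0, 2π] → ℝ²`: no point of the curve is an umbilic, and a continuous field of directions
`(cos φ(t), sin φ(t))` along `γ`, tangent to the flow, turns in total by the angle `2πk`.
The direction is only determined up to sign, so `k` is a half-integer in general. -/
def HasRotationIndex (P : ℝ × ℝ → Fin 3 → ℝ) (γ : ℝ → ℝ × ℝ) (k : ℝ) : Prop :=
  (∀ t ∈ Set.Icc 0 (2 * Real.pi), ¬ IsUmbilic P (γ t)) ∧
  ∃ φ : ℝ → ℝ, ContinuousOn φ (Set.Icc 0 (2 * Real.pi)) ∧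
    (∀ t ∈ Set.Icc 0 (2 * Real.pi),
      IsPrincipalDirection P (γ t) ![Real.cos (φ t), Real.sin (φ t)]) ∧
    φ (2 * Real.pi) - φ 0 = 2 * Real.pi * k

/-- The index at `q` of the curvature line flow of `P` is `k`: this is its rotation index along
every sufficiently small circle around `q`. -/
def HasIndexAt (P : ℝ × ℝ → Fin 3 → ℝ) (q : ℝ × ℝ) (k : ℝ) : Prop :=
  ∃ ε : ℝ, 0 < ε ∧ ∀ r : ℝ, 0 < r → r < ε → HasRotationIndex P (circle q r) k

/-- The graph of `f`, parametrized by `(x, y) ↦ (x, y, f(x, y))`. -/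
def graphMap (f : ℝ × ℝ → ℝ) (p : ℝ × ℝ) : Fin 3 → ℝ :=
  ![p.1, p.2, f p]

/-- The open Euclidean unit disk centered at the origin. -/
def unitDisk : Set (ℝ × ℝ) :=
  {p | p.1 ^ 2 + p.2 ^ 2 < 1}

end C1Umbilic

end

/-! The witness is `waveCap m`, that is f = r² tanh u with u = r^(-1/2) cos(mθ). The factor r² and
the boundedness of tanh make f differentiable at the origin. Its first derivatives are O(√r), so f
is C¹. On a ray where cos(mθ) = 0 and sin θ ≠ 0, f_x is a nonzero multiple of √r, so f is not C².

For the index, work on the circle of radius r in the orthonormal frame rotated by t, with gradient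
(p, q) and Hessian (l, m, n). A direction at angle α from the frame is principal iff X cos²α + Y cos
α sin α + Z sin²α = 0, with X, Y, Z built from the two fundamental forms. In double angles this
reads R cos(2α - β) = -(X + Z), where (X - Z, Y) = R(cos β, sin β). Hence α turns half as much as β,
and the frame itself contributes one full turn.

For small r the vector (X - Z, Y) is never opposite to (-sin kt, cos kt), k being the wave number.
By `jacobian_transversal`, X - Z has the sign of -sin kt; by `jacobian_on_axes`, Y has the sign of
cos kt where sin kt = 0. So β winds k times and the index is 1 + k/2
(`hasRotationIndex_of_winding`). Nonvanishing of the vector also excludes umbilics. -/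

noncomputable section

namespace C1Umbilic

/-! ### Fundamental forms of a graph. -/

/-- The covector `a dx + b dy`. -/
def covector (a b : ℝ) : ℝ × ℝ →L[ℝ] ℝ :=
  a • ContinuousLinearMap.fst ℝ ℝ ℝ + b • ContinuousLinearMap.snd ℝ ℝ ℝ

@[simp]
theorem covector_apply (a b : ℝ) (v : ℝ × ℝ) : covector a b v = a * v.1 + b * v.2 := by
  simp [covector]

theorem hasFDerivAt_graphMap {f : ℝ × ℝ → ℝ} {f' : ℝ × ℝ →L[ℝ] ℝ} {p : ℝ × ℝ}
    (h : HasFDerivAt f f' p) :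
    HasFDerivAt (graphMap f)
      (ContinuousLinearMap.pi ![ContinuousLinearMap.fst ℝ ℝ ℝ,
        ContinuousLinearMap.snd ℝ ℝ ℝ, f']) p := by
  rw [hasFDerivAt_pi']
  intro i
  fin_cases i
  · exact hasFDerivAt_fst
  · exact hasFDerivAt_snd
  · exact h

theorem fderiv_graphMap_injective {f : ℝ × ℝ → ℝ} {f' : ℝ × ℝ →L[ℝ] ℝ} {p : ℝ × ℝ}
    (h : HasFDerivAt f f' p) : Function.Injective (fderiv ℝ (graphMap f) p) := by
  rw [(hasFDerivAt_graphMap h).fderiv]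
  intro v w hvw
  have h0 := congrFun hvw 0
  have h1 := congrFun hvw 1
  exact Prod.ext (by simpa using h0) (by simpa using h1)

section Forms

variable {f gx gy : ℝ × ℝ → ℝ}

theorem partialX_graphMap (hf : ∀ z, HasFDerivAt f (covector (gx z) (gy z)) z) :
    partialX (graphMap f) = fun z => ![1, 0, gx z] := by
  funext z i
  rw [partialX, (hasFDerivAt_graphMap (hf z)).fderiv]
  fin_cases i <;> simp

theorem partialY_graphMap (hf : ∀ z, HasFDerivAt f (covector (gx z) (gy z)) z) :
    partialY (graphMap f) = fun z => ![0, 1, gy z] := by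
  funext z i
  rw [partialY, (hasFDerivAt_graphMap (hf z)).fderiv]
  fin_cases i <;> simp

theorem hasFDerivAt_vec3_const {g : ℝ × ℝ → ℝ} {g' : ℝ × ℝ →L[ℝ] ℝ} {p : ℝ × ℝ} (a b : ℝ)
    (h : HasFDerivAt g g' p) :
    HasFDerivAt (fun z => ![a, b, g z]) (ContinuousLinearMap.pi ![0, 0, g']) p := by
  rw [hasFDerivAt_pi']
  intro i
  fin_cases i
  · exact hasFDerivAt_const a p
  · exact hasFDerivAt_const b p
  · exact h

theorem firstForm_graphMap (hf : ∀ z, HasFDerivAt f (covector (gx z) (gy z)) z) (z : ℝ × ℝ) :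
    firstForm (graphMap f) z =
      !![1 + gx z ^ 2, gx z * gy z; gx z * gy z, 1 + gy z ^ 2] := by
  rw [firstForm, partialX_graphMap hf, partialY_graphMap hf]
  ext i j
  fin_cases i <;> fin_cases j <;> simp [dotProduct, Fin.sum_univ_three] <;> ring

theorem secondForm_graphMap (hf : ∀ z, HasFDerivAt f (covector (gx z) (gy z)) z) {z : ℝ × ℝ}
    {l m n : ℝ} (hx : HasFDerivAt gx (covector l m) z) (hy : HasFDerivAt gy (covector m n) z) :
    secondForm (graphMap f) z =
      (√(1 + gx z ^ 2 + gy z ^ 2))⁻¹ • !![l, m; m, n] := by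
  have hn : unitNormal (graphMap f) z =
      (√(1 + gx z ^ 2 + gy z ^ 2))⁻¹ • ![-gx z, -gy z, 1] := by
    rw [unitNormal, partialX_graphMap hf, partialY_graphMap hf]
    have : crossProduct ![1, 0, gx z] ![0, 1, gy z] = ![-gx z, -gy z, 1] := by
      rw [cross_apply]; simp
    simp only [this]
    congr 3
    simp [dotProduct, Fin.sum_univ_three]
    ring
  rw [secondForm, hn, partialX_graphMap hf, partialY_graphMap hf]
  simp only [partialX, partialY, (hasFDerivAt_vec3_const _ _ hx).fderiv,
    (hasFDerivAt_vec3_const _ _ hy).fderiv]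
  ext i j
  fin_cases i <;> fin_cases j <;> simp [dotProduct, Fin.sum_univ_three] <;> ring

end Forms

/-! ### Principal directions and umbilics in a rotated frame. -/

/-- If `w` makes the Jacobian of the quadratic forms `I = 1 + (p,q)ᵀ(p,q)` and `II` vanish,
it is an eigenvector of `II` relative to `I`. -/
theorem exists_eigenvalue_of_jacobian_eq_zero {p q l m n a b : ℝ} (hab : a ^ 2 + b ^ 2 = 1)
    (h : ((1 + p ^ 2) * m - p * q * l) * a ^ 2 + ((1 + p ^ 2) * n - (1 + q ^ 2) * l) * (a * b) +
      (p * q * n - (1 + q ^ 2) * m) * b ^ 2 = 0) :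
    ∃ κ : ℝ, l * a + m * b = κ * ((1 + p ^ 2) * a + p * q * b) ∧
      m * a + n * b = κ * (p * q * a + (1 + q ^ 2) * b) := by
  have hD : 0 < 1 + (p * a + q * b) ^ 2 := by positivity
  -- The eigenvalue is the Rayleigh quotient II(w,w) / I(w,w); since |w| = 1, I(w,w) = 1 + (pa +
  -- qb)².
  refine ⟨(l * a ^ 2 + 2 * m * (a * b) + n * b ^ 2) / (1 + (p * a + q * b) ^ 2), ?_, ?_⟩
  · rw [div_mul_eq_mul_div, eq_div_iff hD.ne']
    linear_combination (-b) * h - (l * a + m * b) * hab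
  · rw [div_mul_eq_mul_div, eq_div_iff hD.ne']
    linear_combination a * h - (m * a + n * b) * hab

/-- The geometry of a graph at a point, expressed in the orthonormal frame of the parameter plane
obtained by rotating the standard one by `t`: `(p, q)` is the gradient and `(l, m, n)` the
Hessian in that frame. -/
structure GraphJet (f : ℝ × ℝ → ℝ) (z : ℝ × ℝ) (t p q l m n : ℝ) : Prop where
  first : firstForm (graphMap f) z =
    !![1 + (p * Real.cos t - q * Real.sin t) ^ 2,
      (p * Real.cos t - q * Real.sin t) * (p * Real.sin t + q * Real.cos t);
      (p * Real.cos t - q * Real.sin t) * (p * Real.sin t + q * Real.cos t),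
      1 + (p * Real.sin t + q * Real.cos t) ^ 2]
  second : ∃ k : ℝ, 0 < k ∧ secondForm (graphMap f) z = k •
    !![l * Real.cos t ^ 2 - 2 * m * (Real.cos t * Real.sin t) + n * Real.sin t ^ 2,
      (l - n) * (Real.cos t * Real.sin t) + m * (Real.cos t ^ 2 - Real.sin t ^ 2);
      (l - n) * (Real.cos t * Real.sin t) + m * (Real.cos t ^ 2 - Real.sin t ^ 2),
      l * Real.sin t ^ 2 + 2 * m * (Real.cos t * Real.sin t) + n * Real.cos t ^ 2]

namespace GraphJet

variable {f : ℝ × ℝ → ℝ} {z : ℝ × ℝ} {t p q l m n : ℝ}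

theorem isPrincipalDirection (H : GraphJet f z t p q l m n) {α : ℝ}
    (h : ((1 + p ^ 2) * m - p * q * l) * Real.cos α ^ 2 +
      ((1 + p ^ 2) * n - (1 + q ^ 2) * l) * (Real.cos α * Real.sin α) +
      (p * q * n - (1 + q ^ 2) * m) * Real.sin α ^ 2 = 0) :
    IsPrincipalDirection (graphMap f) z ![Real.cos (t + α), Real.sin (t + α)] := by
  obtain ⟨k, -, h2⟩ := H.second
  obtain ⟨κ, h3, h4⟩ := exists_eigenvalue_of_jacobian_eq_zero (Real.cos_sq_add_sin_sq α) h
  have ht := Real.cos_sq_add_sin_sq t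
  refine ⟨fun h0 => ?_, k * κ, ?_⟩
  · have c0 : Real.cos (t + α) = 0 := by simpa using congrFun h0 0
    have s0 : Real.sin (t + α) = 0 := by simpa using congrFun h0 1
    have := Real.cos_sq_add_sin_sq (t + α)
    rw [c0, s0] at this
    norm_num at this
  · rw [H.first, h2, Real.cos_add, Real.sin_add]
    generalize Real.cos t = c at *
    generalize Real.sin t = s at *
    generalize Real.cos α = a at *
    generalize Real.sin α = b at *
    ext i
    fin_cases i
    · simp [Matrix.mulVec, dotProduct, Fin.sum_univ_two]
      linear_combination k * c * h3 - k * s * h4 + (k * (c * (l * a + m * b) - s * (m * a + n * b))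
        - k * κ * (p * c - q * s) * (p * a + q * b)) * ht
    · simp [Matrix.mulVec, dotProduct, Fin.sum_univ_two]
      linear_combination k * s * h3 + k * c * h4 + (k * (s * (l * a + m * b) + c * (m * a + n * b))
        - k * κ * (p * s + q * c) * (p * a + q * b)) * ht

theorem not_isUmbilic (H : GraphJet f z t p q l m n)
    (h : (1 + p ^ 2) * m - p * q * l - (p * q * n - (1 + q ^ 2) * m) ≠ 0 ∨
      (1 + p ^ 2) * n - (1 + q ^ 2) * l ≠ 0) : ¬ IsUmbilic (graphMap f) z := by
  rintro ⟨κ, hκ⟩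
  obtain ⟨k, hk, h2⟩ := H.second
  rw [H.first, h2] at hκ
  have ht := Real.cos_sq_add_sin_sq t
  have h00 := congrFun (congrFun hκ 0) 0
  have h01 := congrFun (congrFun hκ 0) 1
  have h11 := congrFun (congrFun hκ 1) 1
  simp at h00 h01 h11
  generalize Real.cos t = c at *
  generalize Real.sin t = s at *
  -- Rotating the matrix identity back to the adapted frame gives k·II = κ·I entry by entry.
  have e1 : k * l = κ * (1 + p ^ 2) := by
    linear_combination c ^ 2 * h00 + 2 * c * s * h01 + s ^ 2 * h11 +
      (κ * (1 + p ^ 2 * (c ^ 2 + s ^ 2 + 1)) - k * l * (c ^ 2 + s ^ 2 + 1)) * ht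
  have e2 : k * m = κ * (p * q) := by
    linear_combination (-c * s) * h00 + (c ^ 2 - s ^ 2) * h01 + c * s * h11 +
      (κ * p * q * (c ^ 2 + s ^ 2 + 1) - k * m * (c ^ 2 + s ^ 2 + 1)) * ht
  have e3 : k * n = κ * (1 + q ^ 2) := by
    linear_combination s ^ 2 * h00 - 2 * c * s * h01 + c ^ 2 * h11 +
      (κ * (1 + q ^ 2 * (c ^ 2 + s ^ 2 + 1)) - k * n * (c ^ 2 + s ^ 2 + 1)) * ht
  rcases h with h | h
  · refine h (mul_left_cancel₀ hk.ne' ?_)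
    linear_combination (2 + p ^ 2 + q ^ 2) * e2 - p * q * e1 - p * q * e3
  · refine h (mul_left_cancel₀ hk.ne' ?_)
    linear_combination (1 + p ^ 2) * e3 - (1 + q ^ 2) * e1

end GraphJet

/-- This is 4XZ ≤ Y²: the quadratic form of principal directions has real roots. The three
coefficients satisfy a linear relation, and AM-GM applied to it settles the case XZ ≥ 0. It is what
keeps the arccosine argument of `quadratic_form_root` in [-1, 1]. -/
theorem jacobian_discrim_nonneg (p q l m n : ℝ) :
    ((1 + p ^ 2) * m - p * q * l + (p * q * n - (1 + q ^ 2) * m)) ^ 2 ≤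
      ((1 + p ^ 2) * m - p * q * l - (p * q * n - (1 + q ^ 2) * m)) ^ 2 +
        ((1 + p ^ 2) * n - (1 + q ^ 2) * l) ^ 2 := by
  set X := (1 + p ^ 2) * m - p * q * l with hX
  set Y := (1 + p ^ 2) * n - (1 + q ^ 2) * l with hY
  set Z := p * q * n - (1 + q ^ 2) * m with hZ
  have rel : (1 + p ^ 2) * Z + (1 + q ^ 2) * X = p * q * Y := by rw [hX, hY, hZ]; ring
  suffices 4 * (X * Z) ≤ Y ^ 2 by nlinarith
  rcases le_total (X * Z) 0 with h | h
  · nlinarith [sq_nonneg Y]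
  · have h1 : 4 * ((1 + p ^ 2) * (1 + q ^ 2)) * (X * Z) ≤ (p * q * Y) ^ 2 := by
      rw [← rel]; nlinarith [sq_nonneg ((1 + p ^ 2) * Z - (1 + q ^ 2) * X)]
    have h2 : (p * q * Y) ^ 2 ≤ ((1 + p ^ 2) * (1 + q ^ 2)) * Y ^ 2 := by
      have : 0 ≤ (1 + p ^ 2 + q ^ 2) * Y ^ 2 := by positivity
      nlinarith
    have h3 : 0 < (1 + p ^ 2) * (1 + q ^ 2) := by positivity
    refine le_of_mul_le_mul_left ?_ h3
    linarith

/-! ### From the winding of the Jacobian vector to the rotation index. -/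

/-- The polar angle of a root of the binary quadratic form with coefficients `X`, `Y`, `Z`. -/
theorem quadratic_form_root {X Y Z R β : ℝ} (hR : 0 < R) (hX : X - Z = R * Real.cos β)
    (hY : Y = R * Real.sin β) (h : (X + Z) ^ 2 ≤ (X - Z) ^ 2 + Y ^ 2) {α : ℝ}
    (hα : α = (β + Real.arccos (-(X + Z) / R)) / 2) :
    X * Real.cos α ^ 2 + Y * (Real.cos α * Real.sin α) + Z * Real.sin α ^ 2 = 0 := by
  have h1 : (X + Z) ^ 2 ≤ R ^ 2 := by
    rw [hX, hY] at h
    linear_combination h + R ^ 2 * Real.cos_sq_add_sin_sq β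
  have h2 := abs_le_of_sq_le_sq' h1 hR.le
  -- In double angles the quadratic form equals ((X + Z) + R cos(2α - β)) / 2.
  have h3 : R * Real.cos (2 * α - β) = -(X + Z) := by
    have : 2 * α - β = Real.arccos (-(X + Z) / R) := by rw [hα]; ring
    rw [this, Real.cos_arccos]
    · field_simp
    · rw [le_div_iff₀ hR]; linarith
    · rw [div_le_iff₀ hR]; linarith
  rw [Real.cos_sub, Real.cos_two_mul', Real.sin_two_mul] at h3
  linear_combination (1 / 2) * h3 + (1 / 2) * (Real.cos α ^ 2 - Real.sin α ^ 2) * hX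
    + Real.cos α * Real.sin α * hY + (X + Z) / 2 * Real.cos_sq_add_sin_sq α

/-- If, along a closed curve, the winding of the Jacobian vector `(X - Z, Y)` in the frame rotating
once is compared with the curve `i e^{imt}` and never opposite to it, the rotation index of
the curvature line flow is `1 + m / 2`. -/
theorem hasRotationIndex_of_winding {f : ℝ × ℝ → ℝ} {γ : ℝ → ℝ × ℝ} (k : ℕ)
    {p q l m n : ℝ → ℝ} (hp : Continuous p) (hq : Continuous q) (hl : Continuous l)
    (hm : Continuous m) (hn : Continuous n)
    (hper : ∀ g ∈ [p, q, l, m, n], g (2 * Real.pi) = g 0)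
    (H : ∀ t, GraphJet f (γ t) t (p t) (q t) (l t) (m t) (n t))
    {A : ℝ → ℂ} (hA : ∀ t, A t =
      ⟨(1 + p t ^ 2) * m t - p t * q t * l t - (p t * q t * n t - (1 + q t ^ 2) * m t),
        (1 + p t ^ 2) * n t - (1 + q t ^ 2) * l t⟩)
    (hslit : ∀ t, A t * ⟨-Real.sin (k * t), -Real.cos (k * t)⟩ ∈ Complex.slitPlane) :
    HasRotationIndex (graphMap f) γ (1 + (k : ℝ) / 2) := by
  have hAc : Continuous A := by
    have : A = fun t => (((1 + p t ^ 2) * m t - p t * q t * l t -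
        (p t * q t * n t - (1 + q t ^ 2) * m t) : ℝ) : ℂ) +
        (((1 + p t ^ 2) * n t - (1 + q t ^ 2) * l t : ℝ) : ℂ) * Complex.I := by
      funext t
      rw [hA t]
      exact Complex.mk_eq_add_mul_I _ _
    rw [this]
    fun_prop
  have hWc : Continuous fun t : ℝ => (⟨-Real.sin (k * t), -Real.cos (k * t)⟩ : ℂ) := by
    have : (fun t : ℝ => (⟨-Real.sin (k * t), -Real.cos (k * t)⟩ : ℂ)) =
        fun t : ℝ => ((-Real.sin (k * t) : ℝ) : ℂ) + ((-Real.cos (k * t) : ℝ) : ℂ) * Complex.I := by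
      funext t
      exact Complex.mk_eq_add_mul_I _ _
    rw [this]
    fun_prop
  have hA0 : ∀ t, A t ≠ 0 := fun t h0 => Complex.slitPlane_ne_zero (hslit t) (by rw [h0, zero_mul])
  -- The second factor is the conjugate of i e^{ikt}, so θ is the angle from i e^{ikt} to A,
  -- continuous because the product avoids the cut.
  have hcθ : Continuous fun t => Complex.arg (A t * ⟨-Real.sin (k * t), -Real.cos (k * t)⟩) :=
    Complex.continuousOn_arg.comp_continuous (hAc.mul hWc) hslit
  set θ := fun t => Complex.arg (A t * ⟨-Real.sin (k * t), -Real.cos (k * t)⟩) with hθ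
  have hnorm : ∀ t, ‖A t * ⟨-Real.sin (k * t), -Real.cos (k * t)⟩‖ = ‖A t‖ := by
    intro t
    rw [norm_mul]
    have : ‖(⟨-Real.sin (k * t), -Real.cos (k * t)⟩ : ℂ)‖ = 1 := by
      rw [Complex.norm_def, Complex.normSq_mk]
      have := Real.sin_sq_add_cos_sq (k * t)
      rw [Real.sqrt_eq_one]
      linear_combination this
    rw [this, mul_one]
  have hpolar : ∀ t, (A t).re = ‖A t‖ * Real.cos (k * t + Real.pi / 2 + θ t) ∧
      (A t).im = ‖A t‖ * Real.sin (k * t + Real.pi / 2 + θ t) := by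
    intro t
    have hc := Complex.norm_mul_cos_arg (A t * ⟨-Real.sin (k * t), -Real.cos (k * t)⟩)
    have hs := Complex.norm_mul_sin_arg (A t * ⟨-Real.sin (k * t), -Real.cos (k * t)⟩)
    rw [hnorm] at hc hs
    simp only [Complex.mul_re, Complex.mul_im] at hc hs
    have e : k * t + Real.pi / 2 + θ t = (k * t + θ t) + Real.pi / 2 := by ring
    rw [e, Real.cos_add_pi_div_two, Real.sin_add_pi_div_two, Real.sin_add, Real.cos_add]
    have h1 := Real.sin_sq_add_cos_sq (k * t)
    change ‖A t‖ * Real.cos (θ t) = _ at hc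
    change ‖A t‖ * Real.sin (θ t) = _ at hs
    constructor
    · linear_combination Real.sin (k * t) * hc + Real.cos (k * t) * hs - (A t).re * h1
    · linear_combination (-Real.cos (k * t)) * hc + Real.sin (k * t) * hs - (A t).im * h1
  set S := fun t => (1 + p t ^ 2) * m t - p t * q t * l t +
    (p t * q t * n t - (1 + q t ^ 2) * m t) with hS
  -- Here β = kt + π/2 + θ is a continuous argument of A.
  set α := fun t =>
    (k * t + Real.pi / 2 + θ t + Real.arccos (-(S t) / ‖A t‖)) / 2 with hα
  have hαc : Continuous α := by
    have h1 : Continuous fun t => -(S t) / ‖A t‖ :=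
      Continuous.div (by fun_prop) hAc.norm fun t => norm_ne_zero_iff.2 (hA0 t)
    have h2 : Continuous fun t => Real.arccos (-(S t) / ‖A t‖) := Real.continuous_arccos.comp h1
    fun_prop
  have hre : ∀ t, (A t).re = (1 + p t ^ 2) * m t - p t * q t * l t -
      (p t * q t * n t - (1 + q t ^ 2) * m t) := fun t => by rw [hA]
  have him : ∀ t, (A t).im = (1 + p t ^ 2) * n t - (1 + q t ^ 2) * l t := fun t => by rw [hA]
  refine ⟨fun t _ => (H t).not_isUmbilic ?_, fun t => t + α t, by fun_prop, fun t _ => ?_, ?_⟩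
  · rw [← hre, ← him]
    by_contra hcon
    push Not at hcon
    exact hA0 t (Complex.ext hcon.1 hcon.2)
  · refine (H t).isPrincipalDirection
      (quadratic_form_root (norm_pos_iff.2 (hA0 t)) ?_ ?_ (jacobian_discrim_nonneg _ _ _ _ _) rfl)
    · rw [← hre, (hpolar t).1]
    · rw [← him, (hpolar t).2]
  · simp only [List.mem_cons, List.not_mem_nil, or_false, forall_eq_or_imp, forall_eq] at hper
    obtain ⟨h1, h2, h3, h4, h5⟩ := hper
    have hA2 : A (2 * Real.pi) = A 0 := by rw [hA, hA, h1, h2, h3, h4, h5]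
    have hS2 : S (2 * Real.pi) = S 0 := by simp only [hS]; rw [h1, h2, h3, h4, h5]
    -- θ closes up because k is an integer, so only kt/2 contributes to the increment of α.
    have hθ2 : θ (2 * Real.pi) = θ 0 := by
      simp only [hθ]
      have hs : Real.sin (k * (2 * Real.pi)) = 0 := by
        simpa using Real.sin_add_nat_mul_two_pi 0 k
      rw [hA2, hs, Real.cos_nat_mul_two_pi]
      simp
    simp only [hα]
    rw [hA2, hS2, hθ2]
    ring

/-! ### Hyperbolic tangent and the homogeneous waves. -/

theorem hasDerivAt_tanh (x : ℝ) : HasDerivAt Real.tanh (1 - Real.tanh x ^ 2) x := by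
  have h := (Real.hasDerivAt_sinh x).div (Real.hasDerivAt_cosh x) (Real.cosh_pos x).ne'
  have e : Real.tanh = Real.sinh / Real.cosh := by
    funext y; exact Real.tanh_eq_sinh_div_cosh y
  rw [e]
  refine h.congr_deriv ?_
  have := (Real.cosh_pos x).ne'
  simp only [Pi.div_apply]
  field_simp

theorem continuous_tanh : Continuous Real.tanh :=
  continuous_iff_continuousAt.2 fun x => (hasDerivAt_tanh x).continuousAt

theorem analyticAt_tanh (x : ℝ) : AnalyticAt ℝ Real.tanh x := by
  have e : Real.tanh = fun y => Real.sinh y / Real.cosh y := by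
    funext y; exact Real.tanh_eq_sinh_div_cosh y
  rw [e]
  exact Real.analyticAt_sinh.div Real.analyticAt_cosh (Real.cosh_pos x).ne'

/-- The square of the Euclidean distance to the origin. -/
def sqRadius (z : ℝ × ℝ) : ℝ := z.1 ^ 2 + z.2 ^ 2

theorem sqRadius_nonneg (z : ℝ × ℝ) : 0 ≤ sqRadius z := by unfold sqRadius; positivity

theorem sqRadius_pos {z : ℝ × ℝ} (hz : z ≠ 0) : 0 < sqRadius z := by
  refine (sqRadius_nonneg z).lt_of_ne fun h => hz ?_
  unfold sqRadius at h
  exact Prod.ext (by simp only [Prod.fst_zero]; nlinarith [sq_nonneg z.1, sq_nonneg z.2])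
    (by simp only [Prod.snd_zero]; nlinarith [sq_nonneg z.1, sq_nonneg z.2])

theorem hasFDerivAt_covector_of {f : ℝ × ℝ → ℝ} {f' : ℝ × ℝ →L[ℝ] ℝ} {z : ℝ × ℝ} {a b : ℝ}
    (h : HasFDerivAt f f' z) (ha : f' (1, 0) = a) (hb : f' (0, 1) = b) :
    HasFDerivAt f (covector a b) z := by
  convert h using 1
  refine ContinuousLinearMap.ext fun v => ?_
  have : v = v.1 • ((1, 0) : ℝ × ℝ) + v.2 • ((0, 1) : ℝ × ℝ) := by ext <;> simp
  conv_rhs => rw [this, map_add, map_smul, map_smul, ha, hb]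
  simp [mul_comm]

/-- The real and imaginary parts of `(x + iy) ^ k`. -/
def reImPow : ℕ → ℝ × ℝ → ℝ × ℝ
  | 0, _ => (1, 0)
  | k + 1, z => (z.1 * (reImPow k z).1 - z.2 * (reImPow k z).2,
      z.1 * (reImPow k z).2 + z.2 * (reImPow k z).1)

/-- Uses k z^(k-1) = k z̄ z^k / |z|², which keeps the exponent k and avoids truncated subtraction.
-/
theorem hasFDerivAt_reImPow (k : ℕ) {z : ℝ × ℝ} (hz : z ≠ 0) :
    HasFDerivAt (fun w => (reImPow k w).1)
      (covector (k * (z.1 * (reImPow k z).1 + z.2 * (reImPow k z).2) / sqRadius z)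
        (k * (z.2 * (reImPow k z).1 - z.1 * (reImPow k z).2) / sqRadius z)) z ∧
    HasFDerivAt (fun w => (reImPow k w).2)
      (covector (k * (z.1 * (reImPow k z).2 - z.2 * (reImPow k z).1) / sqRadius z)
        (k * (z.2 * (reImPow k z).2 + z.1 * (reImPow k z).1) / sqRadius z)) z := by
  have h0 := (sqRadius_pos hz).ne'
  induction k with
  | zero =>
    constructor
    · exact hasFDerivAt_covector_of (hasFDerivAt_const (1 : ℝ) z) (by simp) (by simp)
    · exact hasFDerivAt_covector_of (hasFDerivAt_const (0 : ℝ) z) (by simp) (by simp)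
  | succ k ih =>
    obtain ⟨h1, h2⟩ := ih
    have hx : HasFDerivAt (fun w : ℝ × ℝ => w.1) (ContinuousLinearMap.fst ℝ ℝ ℝ) z :=
      hasFDerivAt_fst
    have hy : HasFDerivAt (fun w : ℝ × ℝ => w.2) (ContinuousLinearMap.snd ℝ ℝ ℝ) z :=
      hasFDerivAt_snd
    constructor
    · refine hasFDerivAt_covector_of ((hx.mul h1).sub (hy.mul h2)) ?_ ?_ <;>
      · simp only [reImPow]
        simp
        field_simp
        unfold sqRadius
        ring
    · refine hasFDerivAt_covector_of ((hx.mul h2).add (hy.mul h1)) ?_ ?_ <;>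
      · simp only [reImPow]
        simp
        field_simp
        unfold sqRadius
        ring

theorem reImPow_polar (k : ℕ) (r t : ℝ) :
    reImPow k (r * Real.cos t, r * Real.sin t) =
      (r ^ k * Real.cos (k * t), r ^ k * Real.sin (k * t)) := by
  induction k with
  | zero => simp [reImPow]
  | succ k ih =>
    simp only [reImPow, ih]
    have : ((k + 1 : ℕ) : ℝ) * t = k * t + t := by push_cast; ring
    rw [this, Real.cos_add, Real.sin_add]
    ext <;> simp only <;> ring

/-- The exponent making `ρ ^ b z ^ k` homogeneous of degree `-1/2`, where `ρ = |z|²`. -/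
def homExponent (k : ℕ) : ℝ := -(k / 2 + 1 / 4)

/-- The function `r ^ (-1/2) cos (k θ)`. -/
def cosWave (k : ℕ) (z : ℝ × ℝ) : ℝ := sqRadius z ^ homExponent k * (reImPow k z).1

/-- The function `r ^ (-1/2) sin (k θ)`. -/
def sinWave (k : ℕ) (z : ℝ × ℝ) : ℝ := sqRadius z ^ homExponent k * (reImPow k z).2

theorem hasFDerivAt_sqRadius (z : ℝ × ℝ) :
    HasFDerivAt sqRadius (covector (2 * z.1) (2 * z.2)) z := by
  have hx : HasFDerivAt (fun w : ℝ × ℝ => w.1) (ContinuousLinearMap.fst ℝ ℝ ℝ) z :=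
      hasFDerivAt_fst
  have hy : HasFDerivAt (fun w : ℝ × ℝ => w.2) (ContinuousLinearMap.snd ℝ ℝ ℝ) z :=
      hasFDerivAt_snd
  exact hasFDerivAt_covector_of ((hx.pow 2).add (hy.pow 2)) (by simp) (by simp)

theorem hasFDerivAt_waves (k : ℕ) {z : ℝ × ℝ} (hz : z ≠ 0) :
    HasFDerivAt (cosWave k)
      (covector ((-(z.1 * cosWave k z) / 2 + k * (z.2 * sinWave k z)) / sqRadius z)
        ((-(z.2 * cosWave k z) / 2 - k * (z.1 * sinWave k z)) / sqRadius z)) z ∧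
    HasFDerivAt (sinWave k)
      (covector ((-(z.1 * sinWave k z) / 2 - k * (z.2 * cosWave k z)) / sqRadius z)
        ((-(z.2 * sinWave k z) / 2 + k * (z.1 * cosWave k z)) / sqRadius z)) z := by
  have h0 := (sqRadius_pos hz).ne'
  have hρ := (hasFDerivAt_sqRadius z).rpow_const (p := homExponent k) (Or.inl h0)
  rw [Real.rpow_sub_one h0] at hρ
  obtain ⟨h1, h2⟩ := hasFDerivAt_reImPow k hz
  constructor
  · refine hasFDerivAt_covector_of (hρ.mul h1) ?_ ?_ <;>
    · simp [cosWave, sinWave]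
      field_simp
      unfold homExponent
      ring
  · refine hasFDerivAt_covector_of (hρ.mul h2) ?_ ?_ <;>
    · simp [cosWave, sinWave]
      field_simp
      unfold homExponent
      ring

theorem sqRadius_polar (r t : ℝ) : sqRadius (r * Real.cos t, r * Real.sin t) = r ^ 2 := by
  simp only [sqRadius]
  linear_combination r ^ 2 * Real.cos_sq_add_sin_sq t

theorem waves_polar (k : ℕ) {r : ℝ} (hr : 0 < r) (t : ℝ) :
    cosWave k (r * Real.cos t, r * Real.sin t) = (√r)⁻¹ * Real.cos (k * t) ∧
    sinWave k (r * Real.cos t, r * Real.sin t) = (√r)⁻¹ * Real.sin (k * t) := by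
  have h : (r ^ 2) ^ homExponent k * r ^ k = (√r)⁻¹ := by
    rw [← Real.rpow_natCast r 2, ← Real.rpow_mul hr.le, ← Real.rpow_natCast r k,
      ← Real.rpow_add hr, Real.sqrt_eq_rpow, ← Real.rpow_neg hr.le]
    congr 1
    unfold homExponent
    push_cast
    ring
  unfold cosWave sinWave
  rw [sqRadius_polar, reImPow_polar, ← h]
  constructor <;> ring

theorem exists_polar (z : ℝ × ℝ) :
    ∃ t, z = (√(sqRadius z) * Real.cos t, √(sqRadius z) * Real.sin t) := by
  refine ⟨Complex.arg ⟨z.1, z.2⟩, ?_⟩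
  have h : √(sqRadius z) = ‖(⟨z.1, z.2⟩ : ℂ)‖ := by
    rw [Complex.norm_def, Complex.normSq_mk, sqRadius]; ring_nf
  rw [h, Complex.norm_mul_cos_arg, Complex.norm_mul_sin_arg]

/-- At the origin a zero base raised to a nonzero real power is 0 by convention. -/
theorem waves_zero (k : ℕ) : cosWave k 0 = 0 ∧ sinWave k 0 = 0 := by
  have h : homExponent k ≠ 0 := by
    have : (0 : ℝ) ≤ k := Nat.cast_nonneg k
    unfold homExponent
    linarith
  simp [cosWave, sinWave, sqRadius, Real.zero_rpow h]

theorem cosWave_sq_add_sinWave_sq (k : ℕ) (z : ℝ × ℝ) :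
    cosWave k z ^ 2 + sinWave k z ^ 2 = (√(sqRadius z))⁻¹ := by
  rcases eq_or_ne z 0 with rfl | hz
  · simp [waves_zero, sqRadius]
  · have hr : 0 < √(sqRadius z) := Real.sqrt_pos.2 (sqRadius_pos hz)
    obtain ⟨t, ht⟩ := exists_polar z
    obtain ⟨h1, h2⟩ := waves_polar k hr t
    rw [← ht] at h1 h2
    rw [h1, h2]
    have h3 : ((√√(sqRadius z))⁻¹) ^ 2 = (√(sqRadius z))⁻¹ := by
      rw [inv_pow, Real.sq_sqrt hr.le]
    linear_combination h3 + ((√√(sqRadius z))⁻¹) ^ 2 * Real.cos_sq_add_sin_sq (k * t)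

/-! ### The witness function and its derivatives. -/

/-- The function `r² tanh (r ^ (-1/2) cos (k θ))`. -/
def waveCap (k : ℕ) (z : ℝ × ℝ) : ℝ := sqRadius z * Real.tanh (cosWave k z)

/-- The derivative of `waveCap k` in the first coordinate. -/
def waveCapX (k : ℕ) (z : ℝ × ℝ) : ℝ :=
  2 * z.1 * Real.tanh (cosWave k z) +
    (1 - Real.tanh (cosWave k z) ^ 2) * (-(1 / 2) * (z.1 * cosWave k z) + k * (z.2 * sinWave k z))

/-- The derivative of `waveCap k` in the second coordinate. -/
def waveCapY (k : ℕ) (z : ℝ × ℝ) : ℝ :=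
  2 * z.2 * Real.tanh (cosWave k z) +
    (1 - Real.tanh (cosWave k z) ^ 2) * (-(1 / 2) * (z.2 * cosWave k z) - k * (z.1 * sinWave k z))

theorem abs_waveCap_le (k : ℕ) (z : ℝ × ℝ) : |waveCap k z| ≤ 2 * ‖z‖ ^ 2 := by
  have h1 : sqRadius z ≤ 2 * ‖z‖ ^ 2 := by
    have hx := sq_le_sq' (neg_le_of_abs_le (norm_fst_le z)) (le_of_abs_le (norm_fst_le z))
    have hy := sq_le_sq' (neg_le_of_abs_le (norm_snd_le z)) (le_of_abs_le (norm_snd_le z))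
    unfold sqRadius
    linarith
  rw [waveCap, abs_mul, abs_of_nonneg (sqRadius_nonneg z)]
  nlinarith [Real.abs_tanh_lt_one (cosWave k z), sqRadius_nonneg z]

/-- At the origin f = O(‖z‖²), and both derivative formulas evaluate to 0 there. Validity at every
point, origin included, is what `firstForm_graphMap` and `secondForm_graphMap` ask for. -/
theorem hasFDerivAt_waveCap (k : ℕ) (z : ℝ × ℝ) :
    HasFDerivAt (waveCap k) (covector (waveCapX k z) (waveCapY k z)) z := by
  rcases eq_or_ne z 0 with rfl | hz
  · have h0 : covector (waveCapX k 0) (waveCapY k 0) = 0 := by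
      ext <;> simp [waveCapX, waveCapY]
    rw [h0]
    refine HasFDerivAt.of_isLittleO ?_
    have : waveCap k 0 = 0 := by simp [waveCap, sqRadius]
    simp only [this, sub_zero, zero_apply]
    refine Asymptotics.IsBigO.trans_isLittleO (g := fun z : ℝ × ℝ => ‖z‖ ^ 2) ?_ ?_
    · refine Asymptotics.IsBigO.of_bound 2 (Filter.Eventually.of_forall fun w => ?_)
      rw [Real.norm_eq_abs, norm_pow, norm_norm]
      exact abs_waveCap_le k w
    · exact Asymptotics.isLittleO_norm_pow_id one_lt_two
  · have h0 := (sqRadius_pos hz).ne'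
    have h1 := (hasDerivAt_tanh (cosWave k z)).comp_hasFDerivAt z (hasFDerivAt_waves k hz).1
    refine hasFDerivAt_covector_of ((hasFDerivAt_sqRadius z).mul h1) ?_ ?_ <;>
    · simp [waveCapX, waveCapY]
      field_simp
      ring

theorem analyticAt_waveCap (k : ℕ) {z : ℝ × ℝ} (hz : z ≠ 0) : AnalyticAt ℝ (waveCap k) z := by
  have hx : AnalyticAt ℝ (fun w : ℝ × ℝ => w.1) z := analyticAt_fst
  have hy : AnalyticAt ℝ (fun w : ℝ × ℝ => w.2) z := analyticAt_snd
  have hρ : AnalyticAt ℝ sqRadius z := (hx.pow 2).add (hy.pow 2)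
  have hne : {w : ℝ × ℝ | w ≠ 0} ∈ 𝓝 z := isOpen_ne.mem_nhds hz
  have hpow : ∀ k, AnalyticAt ℝ (fun w => (reImPow k w).1) z ∧
      AnalyticAt ℝ (fun w => (reImPow k w).2) z := by
    intro k
    induction k with
    | zero => exact ⟨analyticAt_const, analyticAt_const⟩
    | succ k ih =>
      exact ⟨(hx.mul ih.1).sub (hy.mul ih.2), (hx.mul ih.2).add (hy.mul ih.1)⟩
  have he : AnalyticAt ℝ (fun w => Real.exp (Real.log (sqRadius w) * homExponent k)) z :=
    (((analyticAt_log (sqRadius_pos hz)).comp hρ).mul analyticAt_const).rexp'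
  have hr : AnalyticAt ℝ (fun w => sqRadius w ^ homExponent k) z := by
    refine he.congr ?_
    filter_upwards [hne] with w hw
    exact (Real.rpow_def_of_pos (sqRadius_pos hw) _).symm
  exact hρ.mul ((analyticAt_tanh _).comp (hr.mul (hpow k).1))

theorem hasFDerivAt_waveCapX_waveCapY (k : ℕ) {z : ℝ × ℝ} (hz : z ≠ 0) {φ d u v ux uy vx vy : ℝ}
    (hu : u = cosWave k z) (hv : v = sinWave k z) (hφ : φ = Real.tanh u) (hd : d = 1 - φ ^ 2)
    (hux : ux = (-(z.1 * u) / 2 + k * (z.2 * v)) / sqRadius z)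
    (huy : uy = (-(z.2 * u) / 2 - k * (z.1 * v)) / sqRadius z)
    (hvx : vx = (-(z.1 * v) / 2 - k * (z.2 * u)) / sqRadius z)
    (hvy : vy = (-(z.2 * v) / 2 + k * (z.1 * u)) / sqRadius z) :
    HasFDerivAt (waveCapX k) (covector
      (2 * φ + 2 * z.1 * d * ux - 2 * φ * d * ux * (-(z.1 * u) / 2 + k * (z.2 * v)) +
        d * (-u / 2 - z.1 * ux / 2 + k * (z.2 * vx)))
      (2 * z.1 * d * uy - 2 * φ * d * uy * (-(z.1 * u) / 2 + k * (z.2 * v)) +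
        d * (-(z.1 * uy) / 2 + k * v + k * (z.2 * vy)))) z ∧
    HasFDerivAt (waveCapY k) (covector
      (2 * z.2 * d * ux - 2 * φ * d * ux * (-(z.2 * u) / 2 - k * (z.1 * v)) +
        d * (-(z.2 * ux) / 2 - k * v - k * (z.1 * vx)))
      (2 * φ + 2 * z.2 * d * uy - 2 * φ * d * uy * (-(z.2 * u) / 2 - k * (z.1 * v)) +
        d * (-u / 2 - z.2 * uy / 2 - k * (z.1 * vy)))) z := by
  have hx : HasFDerivAt (fun w : ℝ × ℝ => w.1) (ContinuousLinearMap.fst ℝ ℝ ℝ) z :=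
      hasFDerivAt_fst
  have hy : HasFDerivAt (fun w : ℝ × ℝ => w.2) (ContinuousLinearMap.snd ℝ ℝ ℝ) z :=
      hasFDerivAt_snd
  obtain ⟨h1, h2⟩ := hasFDerivAt_waves k hz
  rw [← hu, ← hv] at h1 h2
  rw [← hux, ← huy] at h1
  rw [← hvx, ← hvy] at h2
  have hT : HasFDerivAt (fun w => Real.tanh (cosWave k w)) (d • covector ux uy) z := by
    rw [hd, hφ, hu]
    exact (hasDerivAt_tanh (cosWave k z)).comp_hasFDerivAt z h1
  have hD := (hT.pow 2).const_sub 1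
  constructor
  · refine hasFDerivAt_covector_of (((hx.const_mul 2).mul hT).add
      (hD.mul (((hx.mul h1).const_mul (-(1 / 2))).add ((hy.mul h2).const_mul (k : ℝ))))) ?_ ?_ <;>
    · simp [← hu, ← hv, ← hφ, ← hd]
      ring
  · refine hasFDerivAt_covector_of (((hy.const_mul 2).mul hT).add
      (hD.mul (((hy.mul h1).const_mul (-(1 / 2))).sub ((hx.mul h2).const_mul (k : ℝ))))) ?_ ?_ <;>
    · simp [← hu, ← hv, ← hφ, ← hd]
      ring

/-! ### Estimates for tanh and the Hessian in polar components. -/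

theorem tanh_estimates_of_nonneg {u : ℝ} (hu : 0 ≤ u) :
    u ^ 2 * (1 - Real.tanh u ^ 2) ≤ u * Real.tanh u ∧
    u * Real.tanh u * (1 - Real.tanh u ^ 2) ≤ Real.tanh u ^ 2 ∧
    u ^ 2 * (1 - Real.tanh u ^ 2) ≤ 1 ∧
    (1 ≤ u → u ≤ 2 * (u * Real.tanh u)) := by
  have hS : u ≤ Real.sinh u := Real.self_le_sinh_iff.2 hu
  have hC := Real.one_le_cosh u
  have hCS := Real.cosh_sq u
  have hsub : 1 - Real.tanh u ^ 2 = 1 / Real.cosh u ^ 2 := by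
    rw [Real.tanh_eq_sinh_div_cosh]
    field_simp
    linear_combination hCS
  rw [hsub, Real.tanh_eq_sinh_div_cosh]
  generalize Real.sinh u = S at *
  generalize Real.cosh u = C at *
  have hC0 : 0 < C := by linarith
  have hS0 : 0 ≤ S := hu.trans hS
  -- With 1 - tanh² u = 1/C², the first two estimates both reduce to u ≤ SC.
  have hSC : u ≤ S * C := by nlinarith
  refine ⟨?_, ?_, ?_, fun h1 => ?_⟩
  · rw [mul_one_div, mul_div_assoc', div_le_div_iff₀ (by positivity) hC0]
    have := mul_le_mul_of_nonneg_left hSC (mul_nonneg hu hC0.le)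
    linarith
  · rw [mul_one_div, mul_div_assoc', div_div, div_pow,
      div_le_div_iff₀ (by positivity) (by positivity)]
    have := mul_le_mul_of_nonneg_left hSC (mul_nonneg hS0 (sq_nonneg C))
    linarith
  · rw [mul_one_div, div_le_one (by positivity)]
    nlinarith
  -- For u ≥ 1 also S ≥ 1, so C² = S² + 1 ≤ 4S².
  · have : C ≤ 2 * S := by nlinarith
    have h2 : 1 / 2 ≤ S / C := by rw [div_le_div_iff₀ two_pos hC0]; linarith
    nlinarith

theorem tanh_estimates (u : ℝ) :
    u ^ 2 * (1 - Real.tanh u ^ 2) ≤ u * Real.tanh u ∧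
    u * Real.tanh u * (1 - Real.tanh u ^ 2) ≤ Real.tanh u ^ 2 ∧
    u ^ 2 * (1 - Real.tanh u ^ 2) ≤ 1 ∧
    (1 ≤ |u| → |u| ≤ 2 * (u * Real.tanh u)) := by
  rcases le_total 0 u with h | h
  · rw [abs_of_nonneg h]
    exact tanh_estimates_of_nonneg h
  · have := tanh_estimates_of_nonneg (neg_nonneg.2 h)
    rw [abs_of_nonpos h]
    simpa [Real.tanh_neg] using this

/-- The radial derivative of `r² tanh u`, divided by `r`, where `u = r ^ (-1/2) cos (k θ)`. -/
def radialSlope (u : ℝ) : ℝ := 2 * Real.tanh u - u * (1 - Real.tanh u ^ 2) / 2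

/-- The `(r, r)` component of the Hessian of `r² tanh u`. -/
def hessRR (u : ℝ) : ℝ :=
  2 * Real.tanh u - 5 / 4 * u * (1 - Real.tanh u ^ 2) -
    u ^ 2 * Real.tanh u * (1 - Real.tanh u ^ 2) / 2

/-- The `(r, θ)` component of the Hessian of `r² tanh u`. -/
def hessRT (k : ℕ) (u v : ℝ) : ℝ :=
  -k * v * (1 - Real.tanh u ^ 2) * (1 / 2 + u * Real.tanh u)

/-- The `(θ, θ)` component of the Hessian of `r² tanh u`. -/
def hessTT (k : ℕ) (u v : ℝ) : ℝ :=
  2 * Real.tanh u - (k ^ 2 + 1 / 2) * u * (1 - Real.tanh u ^ 2) -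
    2 * k ^ 2 * v ^ 2 * Real.tanh u * (1 - Real.tanh u ^ 2)

/-- The angular derivative of `r² tanh u`, divided by `r`. -/
def angularSlope (k : ℕ) (r u v : ℝ) : ℝ := -k * r * v * (1 - Real.tanh u ^ 2)

theorem graphJet_waveCap (k : ℕ) {r : ℝ} (hr : 0 < r) (t : ℝ) {u v : ℝ}
    (hu : u = (√r)⁻¹ * Real.cos (k * t)) (hv : v = (√r)⁻¹ * Real.sin (k * t)) :
    GraphJet (waveCap k) (r * Real.cos t, r * Real.sin t) t
      (r * radialSlope u) (angularSlope k r u v) (hessRR u) (hessRT k u v) (hessTT k u v) := by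
  obtain ⟨h1, h2⟩ := waves_polar k hr t
  rw [← hu] at h1
  rw [← hv] at h2
  have hz : ((r * Real.cos t, r * Real.sin t) : ℝ × ℝ) ≠ 0 := by
    intro h
    have := sqRadius_polar r t
    rw [h] at this
    simp [sqRadius] at this
    exact hr.ne' (pow_eq_zero_iff two_ne_zero |>.1 this.symm)
  have ht := Real.cos_sq_add_sin_sq t
  constructor
  · rw [firstForm_graphMap (hasFDerivAt_waveCap k)]
    have e1 : waveCapX k (r * Real.cos t, r * Real.sin t) =
        r * radialSlope u * Real.cos t - angularSlope k r u v * Real.sin t := by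
      rw [waveCapX, h1, h2, radialSlope, angularSlope]
      ring
    have e2 : waveCapY k (r * Real.cos t, r * Real.sin t) =
        r * radialSlope u * Real.sin t + angularSlope k r u v * Real.cos t := by
      rw [waveCapY, h1, h2, radialSlope, angularSlope]
      ring
    rw [e1, e2]
  · obtain ⟨H1, H2⟩ := hasFDerivAt_waveCapX_waveCapY k hz h1.symm h2.symm rfl rfl rfl rfl rfl rfl
    rw [sqRadius_polar] at H1 H2
    have hs := secondForm_graphMap (hasFDerivAt_waveCap k)
      (z := (r * Real.cos t, r * Real.sin t))
      (l := hessRR u * Real.cos t ^ 2 - 2 * hessRT k u v * (Real.cos t * Real.sin t) +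
        hessTT k u v * Real.sin t ^ 2)
      (m := (hessRR u - hessTT k u v) * (Real.cos t * Real.sin t) +
        hessRT k u v * (Real.cos t ^ 2 - Real.sin t ^ 2))
      (n := hessRR u * Real.sin t ^ 2 + 2 * hessRT k u v * (Real.cos t * Real.sin t) +
        hessTT k u v * Real.cos t ^ 2) ?_ ?_
    · exact ⟨_, by positivity, hs⟩
    · convert H1 using 2
      · simp only [hessRR, hessRT, hessTT]
        field_simp
        generalize Real.cos t = c at *
        generalize Real.sin t = s at *
        generalize Real.tanh u = φ at *
        linear_combination 16 * (2 * φ - u * (1 - φ ^ 2) / 2) * ht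
      · simp only [hessRR, hessRT, hessTT]
        field_simp
        generalize Real.cos t = c at *
        generalize Real.sin t = s at *
        generalize Real.tanh u = φ at *
        linear_combination 16 * (k * v * (1 - φ ^ 2)) * ht
    · convert H2 using 2
      · simp only [hessRR, hessRT, hessTT]
        field_simp
        generalize Real.cos t = c at *
        generalize Real.sin t = s at *
        generalize Real.tanh u = φ at *
        linear_combination (-16 * (k * v * (1 - φ ^ 2))) * ht
      · simp only [hessRR, hessRT, hessTT]
        field_simp
        generalize Real.cos t = c at *
        generalize Real.sin t = s at *
        generalize Real.tanh u = φ at *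
        linear_combination 16 * (2 * φ - u * (1 - φ ^ 2) / 2) * ht

/-! ### Winding of the Jacobian vector on small circles. -/

/-- Near the origin the component of the Jacobian vector governing its position relative to
the lines `sin (k θ) = 0` has the sign of `-sin (k θ)`. -/
theorem jacobian_transversal (k : ℕ) {r : ℝ} (hr : 0 < r) (hr4 : r < 1 / 4) (u v : ℝ)
    {p q l m n : ℝ} (hp : p = r * radialSlope u) (hq : q = angularSlope k r u v)
    (hl : l = hessRR u) (hm : m = hessRT k u v) (hn : n = hessTT k u v) :
    ∃ c : ℝ, 0 < c ∧
      (1 + p ^ 2) * m - p * q * l - (p * q * n - (1 + q ^ 2) * m) = -(k * v * c) := by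
  obtain ⟨h1, h2, -, -⟩ := tanh_estimates u
  have hφ := Real.tanh_sq_lt_one u
  refine ⟨(1 - Real.tanh u ^ 2) * ((2 + p ^ 2 + q ^ 2) * (1 / 2 + u * Real.tanh u) -
    r ^ 2 * (radialSlope u * (l + n))), ?_, ?_⟩
  swap
  · rw [hq, hl, hm, hn, hp, hessRT, angularSlope]
    ring
  have hd : 0 < 1 - Real.tanh u ^ 2 := by linarith
  refine mul_pos hd ?_
  -- A bound uniform in u and v: l + n is 4φ minus multiples of u and φ with nonnegative
  -- coefficients. With P the radial slope, Pu ≥ 0 and 0 ≤ Pφ ≤ 2, so P(l + n) ≤ 4Pφ ≤ 8.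
  have hs : radialSlope u * (l + n) ≤ 8 := by
    rw [hl, hn, radialSlope, hessRR, hessTT]
    generalize hφ' : Real.tanh u = φ at *
    generalize hd' : 1 - φ ^ 2 = d at *
    have h0 : 0 ≤ u ^ 2 * d := by positivity
    have hPu : 0 ≤ (2 * φ - u * d / 2) * u := by nlinarith
    have h3 : 0 ≤ u * φ * d := mul_nonneg (h0.trans h1) hd.le
    have hPφ : 0 ≤ (2 * φ - u * d / 2) * φ := by nlinarith
    have hPφ' : (2 * φ - u * d / 2) * φ ≤ 2 := by nlinarith
    have a1 : 0 ≤ (2 * φ - u * d / 2) * u * ((k ^ 2 + 7 / 4) * d) := by positivity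
    have a2 : 0 ≤ (2 * φ - u * d / 2) * φ * (u ^ 2 * d / 2 + 2 * k ^ 2 * v ^ 2 * d) := by positivity
    linarith
  have h0 : 0 ≤ u ^ 2 * (1 - Real.tanh u ^ 2) := by positivity
  have h4 : r ^ 2 * (radialSlope u * (l + n)) ≤ r ^ 2 * 8 :=
    mul_le_mul_of_nonneg_left hs (sq_nonneg r)
  -- The competing term is at least 2 · 1/2 = 1, so r < 1/4 is enough.
  have h5 : r ^ 2 * 8 < 1 := by nlinarith
  have h6 : 0 ≤ (2 + p ^ 2 + q ^ 2) * (u * Real.tanh u) :=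
    mul_nonneg (by positivity) (h0.trans h1)
  nlinarith [sq_nonneg p, sq_nonneg q]

/-- On the lines `sin (k θ) = 0` near the origin, the other component of the Jacobian vector has
the sign of `cos (k θ)`. -/
theorem jacobian_on_axes (k : ℕ) (hk : 0 < k) {u p l n : ℝ} (hu : 4 * k ^ 2 ≤ |u|)
    (hl : l = hessRR u) (hn : n = hessTT k u 0) : 0 < ((1 + p ^ 2) * n - l) * u := by
  obtain ⟨-, -, h3, h4⟩ := tanh_estimates u
  have hk1 : (1 : ℝ) ≤ k ^ 2 := by exact_mod_cast Nat.one_le_pow 2 k hk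
  have h5 := h4 (by linarith)
  have hd : 0 < 1 - Real.tanh u ^ 2 := by linarith [Real.tanh_sq_lt_one u]
  have hu0 : u ≠ 0 := fun h => by rw [h, abs_zero] at hu; linarith
  -- nu = 2u tanh u - (k² + 1/2) u²(1 - tanh² u) ≥ 4k² - (k² + 1/2).
  have hnu : 0 ≤ n * u := by
    rw [hn, hessTT]
    have := mul_le_mul_of_nonneg_left h3 (show (0 : ℝ) ≤ k ^ 2 + 1 / 2 by positivity)
    nlinarith
  have hnl : 0 < (n - l) * u := by
    -- The threshold |u| ≥ 4k² gives u tanh u ≥ 2k², so the last factor is at least 3/4.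
    have e : (n - l) * u = u ^ 2 * (1 - Real.tanh u ^ 2) *
        (u * Real.tanh u / 2 - k ^ 2 + 3 / 4) := by
      rw [hn, hl, hessTT, hessRR]
      ring
    rw [e]
    have : 0 < u ^ 2 := by positivity
    exact mul_pos (mul_pos this hd) (by linarith)
  nlinarith [mul_nonneg (sq_nonneg p) hnu]

theorem hasRotationIndex_waveCap (k : ℕ) (hk : 0 < k) {r : ℝ} (hr : 0 < r)
    (hrk : r * (16 * k ^ 4) < 1) :
    HasRotationIndex (graphMap (waveCap k)) (circle (0, 0) r) (1 + (k : ℝ) / 2) := by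
  have hk1 : (1 : ℝ) ≤ k ^ 2 := by exact_mod_cast Nat.one_le_pow 2 k hk
  have hk0 : (0 : ℝ) < k := by exact_mod_cast hk
  have hr4 : r < 1 / 4 := by nlinarith [one_le_pow₀ hk1 (n := 2)]
  have hsr : 0 < √r := Real.sqrt_pos.2 hr
  -- On the lines sin kt = 0 one has |u| = r^(-1/2); the bound r · 16k⁴ < 1 makes this at least 4k².
  have hs : 4 * (k : ℝ) ^ 2 ≤ (√r)⁻¹ := by
    rw [le_inv_comm₀ (by positivity) hsr]
    refine Real.sqrt_le_iff.2 ⟨by positivity, ?_⟩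
    rw [inv_pow, ← one_div, le_div_iff₀ (by positivity)]
    linarith
  set u := fun t : ℝ => (√r)⁻¹ * Real.cos (k * t) with hu
  set v := fun t : ℝ => (√r)⁻¹ * Real.sin (k * t) with hv
  have hT : Continuous fun t => Real.tanh (u t) := continuous_tanh.comp (by fun_prop)
  have hS : Real.sin (k * (2 * Real.pi)) = Real.sin (k * 0) := by
    simpa using Real.sin_add_nat_mul_two_pi 0 k
  have hC : Real.cos (k * (2 * Real.pi)) = Real.cos (k * 0) := by
    simp
  refine hasRotationIndex_of_winding k (p := fun t => r * radialSlope (u t))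
    (q := fun t => angularSlope k r (u t) (v t)) (l := fun t => hessRR (u t))
    (m := fun t => hessRT k (u t) (v t)) (n := fun t => hessTT k (u t) (v t))
    ?_ ?_ ?_ ?_ ?_ ?_ ?_ (fun t => rfl) ?_
  · unfold radialSlope; fun_prop
  · unfold angularSlope; fun_prop
  · unfold hessRR; fun_prop
  · unfold hessRT; fun_prop
  · unfold hessTT; fun_prop
  · simp [hu, hv, hS, hC]
  · intro t
    simp only [circle, zero_add]
    exact graphJet_waveCap k hr t rfl rfl
  · intro t
    obtain ⟨c, hc, hX⟩ := jacobian_transversal k hr hr4 (u t) (v t) rfl rfl rfl rfl rfl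
    rw [hX]
    set Y := (1 + (r * radialSlope (u t)) ^ 2) * hessTT k (u t) (v t) -
      (1 + angularSlope k r (u t) (v t) ^ 2) * hessRR (u t) with hY
    rw [Complex.mem_slitPlane_iff]
    simp only [Complex.mul_re, Complex.mul_im]
    have hv' : v t = (√r)⁻¹ * Real.sin (k * t) := rfl
    have hu' : u t = (√r)⁻¹ * Real.cos (k * t) := rfl
    have hsi : 0 < (√r)⁻¹ := by positivity
    by_cases h0 : Real.sin (k * t) = 0
    · left
      have hv0 : v t = 0 := by rw [hv', h0, mul_zero]
      have hc1 : |Real.cos (k * t)| = 1 := by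
        have := Real.cos_sq_add_sin_sq (k * t)
        rw [h0] at this
        rw [← abs_one, ← sq_eq_sq_iff_abs_eq_abs]
        linarith
      have hpos := jacobian_on_axes k hk (u := u t) (p := r * radialSlope (u t))
        (by rw [hu', abs_mul, hc1, mul_one, abs_of_pos hsi]; exact hs) rfl rfl
      have hYe : Y = (1 + (r * radialSlope (u t)) ^ 2) * hessTT k (u t) 0 - hessRR (u t) := by
        rw [hY, hv0, angularSlope]
        ring
      rw [← hYe, hu'] at hpos
      have : 0 < Y * Real.cos (k * t) := by
        refine (mul_pos_iff_of_pos_left hsi).1 ?_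
        linarith
      rw [h0]
      linarith
    -- If the imaginary part vanishes, A is a real multiple of i e^{ikt}; comparing real parts
    -- identifies the factor as k r^(-1/2) c > 0.
    · by_cases hi : Y * -Real.sin (k * t) + -(k * v t * c) * -Real.cos (k * t) = 0
      · left
        have hYc : Y = k * (√r)⁻¹ * c * Real.cos (k * t) := by
          refine mul_right_cancel₀ h0 ?_
          rw [hv'] at hi
          linarith
        rw [hYc, hv']
        have h1 := Real.cos_sq_add_sin_sq (k * t)
        have : 0 < k * (√r)⁻¹ * c := by positivity
        have e : -(k * ((√r)⁻¹ * Real.sin (k * t)) * c) * -Real.sin (k * t) -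
          k * (√r)⁻¹ * c * Real.cos (k * t) * -Real.cos (k * t) = k * (√r)⁻¹ * c := by
          linear_combination (k * (√r)⁻¹ * c) * h1
        rw [e]
        exact this
      · right
        intro h
        exact hi (by linarith)

/-! ### Regularity at the origin: C¹ but not C². -/

theorem abs_mul_wave_le (k : ℕ) (z : ℝ × ℝ) {a w : ℝ} (ha : a ^ 2 ≤ sqRadius z)
    (hw : w ^ 2 ≤ cosWave k z ^ 2 + sinWave k z ^ 2) : |a * w| ≤ √√(sqRadius z) := by
  refine Real.abs_le_sqrt ?_
  rw [cosWave_sq_add_sinWave_sq] at hw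
  have h := mul_le_mul ha hw (sq_nonneg w) (sqRadius_nonneg z)
  rw [← div_eq_mul_inv, Real.div_sqrt] at h
  linarith [mul_pow a w 2]

theorem continuous_sqRadius : Continuous sqRadius := by
  unfold sqRadius
  fun_prop

/-- A common shape for both partial derivatives: a coordinate is at most r and a wave at most
r^(-1/2), so each product is at most √r. -/
theorem continuousAt_zero_of_wave_bound (k : ℕ) {g : ℝ × ℝ → ℝ} (h0 : g 0 = 0)
    (hg : ∀ z, ∃ a b c w w' : ℝ, a ^ 2 ≤ sqRadius z ∧ b ^ 2 ≤ sqRadius z ∧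
      w ^ 2 ≤ cosWave k z ^ 2 + sinWave k z ^ 2 ∧ w' ^ 2 ≤ cosWave k z ^ 2 + sinWave k z ^ 2 ∧
      |c| ≤ 1 ∧ g z = 2 * a * Real.tanh (cosWave k z) + c * (-(1 / 2) * (a * w) + k * (b * w'))) :
    ContinuousAt g 0 := by
  have hB : Filter.Tendsto (fun z => 2 * √(sqRadius z) + (1 / 2 + k) * √√(sqRadius z)) (𝓝 0)
      (𝓝 0) := by
    have hc : Continuous fun z => 2 * √(sqRadius z) + (1 / 2 + k) * √√(sqRadius z) := by
      have := continuous_sqRadius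
      fun_prop
    simpa [sqRadius] using hc.tendsto 0
  rw [ContinuousAt, h0]
  refine squeeze_zero_norm (fun z => ?_) hB
  obtain ⟨a, b, c, w, w', ha, hb, hw, hw', hc, e⟩ := hg z
  rw [e, Real.norm_eq_abs]
  have h1 := abs_mul_wave_le k z ha hw
  have h2 := abs_mul_wave_le k z hb hw'
  have h3 : |2 * a * Real.tanh (cosWave k z)| ≤ 2 * √(sqRadius z) := by
    rw [abs_mul, abs_mul, abs_two]
    have := Real.abs_le_sqrt ha
    nlinarith [Real.abs_tanh_lt_one (cosWave k z), abs_nonneg a]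
  have h4 : |c * (-(1 / 2) * (a * w) + k * (b * w'))| ≤ (1 / 2 + k) * √√(sqRadius z) := by
    rw [abs_mul]
    have h5 : |-(1 / 2) * (a * w) + k * (b * w')| ≤ 1 / 2 * |a * w| + k * |b * w'| := by
      refine (abs_add_le _ _).trans_eq ?_
      rw [abs_mul, abs_mul (k : ℝ), abs_neg, Nat.abs_cast,
        abs_of_pos (by norm_num : (0 : ℝ) < 1 / 2)]
    have h6 := mul_le_mul_of_nonneg_left h2 (Nat.cast_nonneg (α := ℝ) k)
    calc _ ≤ 1 * |-(1 / 2) * (a * w) + k * (b * w')| :=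
          mul_le_mul_of_nonneg_right hc (abs_nonneg _)
      _ ≤ _ := by linarith
  linarith [abs_add_le (2 * a * Real.tanh (cosWave k z)) (c * (-(1 / 2) * (a * w) + k * (b * w')))]

theorem abs_one_sub_tanh_sq_le (u : ℝ) : |1 - Real.tanh u ^ 2| ≤ 1 := by
  rw [abs_of_pos (by linarith [Real.tanh_sq_lt_one u])]
  linarith [sq_nonneg (Real.tanh u)]

theorem contDiff_waveCap (k : ℕ) : ContDiff ℝ 1 (waveCap k) := by
  have hX : Continuous (waveCapX k) := by
    refine continuous_iff_continuousAt.2 fun z => ?_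
    rcases eq_or_ne z 0 with rfl | hz
    · refine continuousAt_zero_of_wave_bound k (by simp [waveCapX]) fun z =>
        ⟨z.1, z.2, _, cosWave k z, sinWave k z, ?_, ?_, ?_, ?_, abs_one_sub_tanh_sq_le _, rfl⟩
      · exact le_add_of_nonneg_right (sq_nonneg _)
      · exact le_add_of_nonneg_left (sq_nonneg _)
      · exact le_add_of_nonneg_right (sq_nonneg _)
      · exact le_add_of_nonneg_left (sq_nonneg _)
    · exact (hasFDerivAt_waveCapX_waveCapY k hz rfl rfl rfl rfl rfl rfl rfl rfl).1.continuousAt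
  have hY : Continuous (waveCapY k) := by
    refine continuous_iff_continuousAt.2 fun z => ?_
    rcases eq_or_ne z 0 with rfl | hz
    · refine continuousAt_zero_of_wave_bound k (by simp [waveCapY]) fun z =>
        ⟨z.2, z.1, 1 - Real.tanh (cosWave k z) ^ 2, cosWave k z, -sinWave k z, ?_, ?_, ?_, ?_,
          abs_one_sub_tanh_sq_le _, by rw [waveCapY]; ring⟩
      · exact le_add_of_nonneg_left (sq_nonneg _)
      · exact le_add_of_nonneg_right (sq_nonneg _)
      · exact le_add_of_nonneg_right (sq_nonneg _)
      · rw [neg_sq]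
        exact le_add_of_nonneg_left (sq_nonneg _)
    · exact (hasFDerivAt_waveCapX_waveCapY k hz rfl rfl rfl rfl rfl rfl rfl rfl).2.continuousAt
  refine contDiff_one_iff_hasFDerivAt.2 ⟨_, ?_, hasFDerivAt_waveCap k⟩
  unfold covector
  fun_prop

theorem contDiffAt_graphMap {f : ℝ × ℝ → ℝ} {n : WithTop ℕ∞} {z : ℝ × ℝ} (h : ContDiffAt ℝ n f z) :
    ContDiffAt ℝ n (graphMap f) z := by
  rw [contDiffAt_pi]
  intro i
  fin_cases i
  · exact contDiffAt_fst
  · exact contDiffAt_snd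
  · exact h

/-- On the ray kt = π/2 the cosine wave vanishes and the derivative is exactly k sin t · √r, which
is not O(r). -/
theorem not_differentiableAt_waveCapX (k : ℕ) (hk : 0 < k) :
    ¬ DifferentiableAt ℝ (waveCapX k) 0 := by
  intro h
  have hk0 : (0 : ℝ) < k := by exact_mod_cast hk
  set t := Real.pi / (2 * k) with ht
  have hkt : k * t = Real.pi / 2 := by rw [ht]; field_simp
  have ht0 : 0 < t := by positivity
  have htpi : t < Real.pi := by
    rw [ht, div_lt_iff₀ (by positivity)]
    have : (1 : ℝ) ≤ k := by exact_mod_cast hk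
    nlinarith [Real.pi_pos]
  have hst : 0 < Real.sin t := Real.sin_pos_of_pos_of_lt_pi ht0 htpi
  have hval : ∀ r : ℝ, 0 < r →
      waveCapX k (r * Real.cos t, r * Real.sin t) = k * Real.sin t * √r := by
    intro r hr
    obtain ⟨h1, h2⟩ := waves_polar k hr t
    rw [waveCapX, h1, h2, hkt]
    simp only [Real.cos_pi_div_two, Real.sin_pi_div_two, mul_zero, Real.tanh_zero]
    have : √r ≠ 0 := (Real.sqrt_pos.2 hr).ne'
    field_simp
    rw [Real.sq_sqrt hr.le]
    ring
  have hO := h.hasFDerivAt.isBigO_sub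
  obtain ⟨C, hC⟩ := hO.bound
  have hline : Filter.Tendsto (fun r : ℝ => ((r * Real.cos t, r * Real.sin t) : ℝ × ℝ))
      (𝓝[>] 0) (𝓝 0) := by
    have hc : Continuous fun r : ℝ => ((r * Real.cos t, r * Real.sin t) : ℝ × ℝ) := by fun_prop
    have := (hc.tendsto 0).mono_left (nhdsWithin_le_nhds (s := Set.Ioi 0))
    simpa [← Prod.zero_eq_mk] using this
  have hsq : Filter.Tendsto (fun r : ℝ => C * √r) (𝓝[>] 0) (𝓝 0) := by
    have hc : Continuous fun r : ℝ => C * √r := by fun_prop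
    have := (hc.tendsto 0).mono_left (nhdsWithin_le_nhds (s := Set.Ioi 0))
    simpa using this
  have hpos : 0 < k * Real.sin t := mul_pos hk0 hst
  obtain ⟨r, ⟨hr1, hr2⟩, hr0⟩ :=
    ((hline.eventually hC).and (hsq.eventually (gt_mem_nhds hpos)) |>.and
      self_mem_nhdsWithin).exists
  have hr0 : 0 < r := hr0
  have hX0 : waveCapX k 0 = 0 := by simp [waveCapX]
  rw [hX0, sub_zero, sub_zero, hval r hr0, Real.norm_eq_abs,
    abs_of_nonneg (by positivity)] at hr1
  have hnorm : ‖((r * Real.cos t, r * Real.sin t) : ℝ × ℝ)‖ ≤ r := by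
    rw [Prod.norm_def, Real.norm_eq_abs, Real.norm_eq_abs, abs_mul, abs_mul, abs_of_pos hr0]
    exact max_le (mul_le_of_le_one_right hr0.le (Real.abs_cos_le_one t))
      (mul_le_of_le_one_right hr0.le (Real.abs_sin_le_one t))
  have hsr : 0 < √r := Real.sqrt_pos.2 hr0
  have hle : k * Real.sin t * √r ≤ |C| * √r * √r := by
    rw [mul_assoc |C|, Real.mul_self_sqrt hr0.le]
    calc _ ≤ C * _ := hr1
      _ ≤ |C| * _ := mul_le_mul_of_nonneg_right (le_abs_self C) (norm_nonneg _)
      _ ≤ |C| * r := mul_le_mul_of_nonneg_left hnorm (abs_nonneg C)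
  have hC0 : 0 ≤ C := by
    by_contra hneg
    push Not at hneg
    have h1 := mul_nonpos_of_nonpos_of_nonneg hneg.le
      (norm_nonneg ((r * Real.cos t, r * Real.sin t) : ℝ × ℝ))
    have h2 : 0 < k * Real.sin t * √r := mul_pos hpos hsr
    linarith
  rw [abs_of_nonneg hC0] at hle
  exact absurd (le_of_mul_le_mul_right hle hsr) (not_le.2 hr2)

theorem not_contDiffAt_graphMap_waveCap (k : ℕ) (hk : 0 < k) :
    ¬ ContDiffAt ℝ 2 (graphMap (waveCap k)) 0 := by
  intro h
  have h1 : ContDiffAt ℝ 2 (waveCap k) 0 := contDiffAt_pi.1 h 2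
  have h2 : DifferentiableAt ℝ (fderiv ℝ (waveCap k)) 0 :=
    (h1.fderiv_right (m := 1) (by norm_num)).differentiableAt one_ne_zero
  refine not_differentiableAt_waveCapX k hk ?_
  have e : waveCapX k = fun z => fderiv ℝ (waveCap k) z (1, 0) := by
    funext z
    rw [(hasFDerivAt_waveCap k z).fderiv]
    simp
  rw [e]
  exact h2.clm_apply (differentiableAt_const _)

/-! ### Isolation of the umbilic and conclusion. -/

theorem isOpen_unitDisk : IsOpen unitDisk :=
  isOpen_lt (by fun_prop) continuous_const

theorem eventually_not_isUmbilic_waveCap (k : ℕ) (hk : 0 < k) :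
    ∀ᶠ z in 𝓝[≠] (0 : ℝ × ℝ), ¬ IsUmbilic (graphMap (waveCap k)) z := by
  have hlt : ∀ᶠ z in 𝓝[≠] (0 : ℝ × ℝ), √(sqRadius z) * (16 * k ^ 4) < 1 := by
    have hc : Continuous fun z => √(sqRadius z) * (16 * (k : ℝ) ^ 4) := by
      have := continuous_sqRadius
      fun_prop
    have := (hc.tendsto 0).mono_left (nhdsWithin_le_nhds (s := {0}ᶜ))
    exact this.eventually (gt_mem_nhds (by simp [sqRadius]))
  filter_upwards [hlt, self_mem_nhdsWithin] with z h1 h2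
  obtain ⟨t, ht⟩ := exists_polar z
  have hr : 0 < √(sqRadius z) := Real.sqrt_pos.2 (sqRadius_pos h2)
  -- The rotation index excludes umbilics only for parameters in [0, 2π], so the polar angle is
  -- reduced modulo 2π.
  have hmem := toIcoMod_mem_Ico Real.two_pi_pos 0 t
  rw [zero_add] at hmem
  have h := (hasRotationIndex_waveCap k hk hr h1).1 _ (Set.Ico_subset_Icc_self hmem)
  have e : circle (0, 0) (√(sqRadius z)) (toIcoMod Real.two_pi_pos 0 t) = z := by
    conv_rhs => rw [ht]
    have hc := Real.cos_periodic.sub_zsmul_eq (x := t) (toIcoDiv Real.two_pi_pos 0 t)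
    have hs := Real.sin_periodic.sub_zsmul_eq (x := t) (toIcoDiv Real.two_pi_pos 0 t)
    simp only [circle, toIcoMod, hc, hs, zero_add]
  rwa [e] at h

theorem isC1Umbilic_waveCap (k : ℕ) (hk : 0 < k) :
    IsC1Umbilic (graphMap (waveCap k)) unitDisk (0, 0) where
  isOpen := isOpen_unitDisk
  mem := by simp [unitDisk]
  contDiffOn := fun z _ => (contDiffAt_graphMap (contDiff_waveCap k).contDiffAt).contDiffWithinAt
  immersion := fun z _ => fderiv_graphMap_injective (hasFDerivAt_waveCap k z)
  smooth := fun z hz =>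
    (contDiffAt_graphMap (analyticAt_waveCap k hz.2).contDiffAt).contDiffWithinAt
  not_C2 := not_contDiffAt_graphMap_waveCap k hk
  isolated := eventually_not_isUmbilic_waveCap k hk

end C1Umbilic

end

theorem theorem1p1 (m : ℕ) (hm : 0 < m) :
    ∃ f : ℝ × ℝ → ℝ,
      ContDiffOn ℝ 1 f C1Umbilic.unitDisk ∧
      AnalyticOnNhd ℝ f (C1Umbilic.unitDisk \ {(0, 0)}) ∧
      C1Umbilic.IsC1Umbilic (C1Umbilic.graphMap f) C1Umbilic.unitDisk (0, 0) ∧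
      C1Umbilic.HasIndexAt (C1Umbilic.graphMap f) (0, 0) (1 + (m : ℝ) / 2) := by
  refine ⟨C1Umbilic.waveCap m, (C1Umbilic.contDiff_waveCap m).contDiffOn,
    fun z hz => C1Umbilic.analyticAt_waveCap m hz.2, C1Umbilic.isC1Umbilic_waveCap m hm,
    1 / (16 * (m : ℝ) ^ 4), by positivity, fun r hr hrm => ?_⟩
  exact C1Umbilic.hasRotationIndex_waveCap m hm hr ((lt_div_iff₀ (by positivity)).1 hrm)
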